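/- Let $G$ be a connected (simple, possibly infinite) graph. Two rays of $G$ are edge-equivalent if for every finite set $F$ of edges they have tails in the same component of $G-F$; the classes are the edge-ends of $G$, and $\Omega_E(G)$ is the set of edge-ends. A region of $G$ is (the vertex set of) a non-empty connected subgraph $C$ such that only finitely many edges of $G$ leave $C$; an edge-end lives in a set $C$ of vertices if all its rays have a tail in $C$, $\Omega_E(C)$ denotes the set of edge-ends living in $C$, and $\|C\| = C\cup\Omega_E(C)$. The sets $\Omega_E(C)$, with $C$ a region, form a basis of the topology of $\Omega_E(G)$, and the sets $\|C\|$, with $C$ a region, form a basis of the topology of $\|G\| = V(G)\cup\Omega_E(G)$. A vertex $v$ edge-dominates $\omega\in\Omega_E(G)$ if for every finite set $F$ of edges $\omega$ lives in the component of $G-F$ that contains $v$; $\omega$ is dominated if some vertex edge-dominates it. The $\omega$-edge-blocks of $G$ are the classes of the relation "no finite set of edges separates $x$ from $y$" on $V(G)$. Let $T$ be a tree and let $\mathcal X = (X_t)_{t\in T}$ be a partition of $V(G)$ into non-empty sets indexed by the nodes of $T$, so that $(T,\mathcal X)$ is a tree-cut decomposition of $G$. For an edge $e=t_1t_2$ of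 $T$ let $T_1\ni t_1$ and $T_2\ni t_2$ be the two components of $T-e$. Suppose that - for every edge $e=t_1t_2$ of $T$, $G$ has only finitely many edges between $\bigcup_{t\in T_1}X_t$ and $\bigcup_{t\in T_2}X_t$ (finite adhesion), - the parts $X_t$ are exactly the $\omega$-edge-blocks of $G$, and - for every edge $t_1t_2$ of $T$ there is an edge of $G$ between $X_{t_1}$ and $X_{t_2}$. Each edge-end $\omega$ of $G$ orients every edge $e=t_1t_2$ of $T$ towards the component $T_i$ for which $\omega$ lives in $\bigcup_{t\in T_i}X_t$. Then for every $\omega$ there is exactly one $x\in\|T\|$ (a node or an end of $T$) towards which all edges of $T$ point, i.e. which lies in $\|T_i\|$ whenever an edge is oriented towards $T_i$. The map $\varphi\colon\Omega_E(G)\to\|T\|$ that sends each $\omega$ to this $x$ is a topological embedding. Moreover, 1. $\varphi$ restricts to a bijection between the undominated edge-ends of $G$ and the ends of $T$, and 2. $\varphi$ restricts to an injection from the dominated edge-ends of $G$ to the nodes of $T$, and for every dominated edge-end $\omega$ the set $X_{\varphi(\omega)}$ is precisely the set of vertices of $G$ that edge-dominate $\omega$. -/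

import Mathlib

open Set Filter Topology

namespace SimpleGraph

variable {V : Type*}

/-- A ray of `G`: a one-way infinite path. -/
@[ext]
structure Ray (G : SimpleGraph V) where
  /-- The vertices of the ray, in order. -/
  toFun : ℕ → V
  injective : Function.Injective toFun
  adj : ∀ n, G.Adj (toFun n) (toFun (n + 1))

/-- The ray `r` has a tail in the set of vertices `C`. -/
def Ray.HasTailIn {G : SimpleGraph V} (r : G.Ray) (C : Set V) : Prop :=
  ∀ᶠ n in atTop, r.toFun n ∈ C

/-- Two rays are edge-equivalent if no finite set of edges separates them: for every finite set
`F` of edges they have tails in the same component of `G - F`. -/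
def EdgeEquiv (G : SimpleGraph V) (r s : G.Ray) : Prop :=
  ∀ F : Set (Sym2 V), F.Finite →
    ∃ C : (G.deleteEdges F).ConnectedComponent, r.HasTailIn C.supp ∧ s.HasTailIn C.supp

/-- After the deletion of finitely many edges, every ray has a tail in some component. -/
theorem Ray.exists_component {G : SimpleGraph V} (r : G.Ray) {F : Set (Sym2 V)} (hF : F.Finite) :
    ∃ C : (G.deleteEdges F).ConnectedComponent, r.HasTailIn C.supp := by
  have hinj : Function.Injective (fun n => s(r.toFun n, r.toFun (n + 1))) := by
    intro a b hab
    rcases Sym2.eq_iff.1 hab with ⟨h, -⟩ | ⟨h, h'⟩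
    · exact r.injective h
    · have h1 := r.injective h
      have h2 := r.injective h'
      omega
  have hfin : {n | s(r.toFun n, r.toFun (n + 1)) ∈ F}.Finite := hF.preimage hinj.injOn
  obtain ⟨N, hN⟩ := hfin.bddAbove
  refine ⟨(G.deleteEdges F).connectedComponentMk (r.toFun (N + 1)), ?_⟩
  refine eventually_atTop.2 ⟨N + 1, fun n hn => ?_⟩
  induction n, hn using Nat.le_induction with
  | base => exact ConnectedComponent.connectedComponentMk_mem
  | succ n hn ih =>
    have hadj : (G.deleteEdges F).Adj (r.toFun n) (r.toFun (n + 1)) := by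
      rw [deleteEdges_adj]
      refine ⟨r.adj n, fun hmem => ?_⟩
      have : n ≤ N := hN hmem
      omega
    rw [ConnectedComponent.mem_supp_iff] at ih ⊢
    rw [← ih]
    exact ConnectedComponent.sound hadj.symm.reachable

theorem edgeEquiv_equivalence (G : SimpleGraph V) : Equivalence G.EdgeEquiv where
  refl r := fun _ hF => (r.exists_component hF).imp fun _ h => ⟨h, h⟩
  symm h := fun F hF => (h F hF).imp fun _ h => h.symm
  trans {r s t} h h' := by
    intro F hF
    obtain ⟨C, hr, hs⟩ := h F hF
    obtain ⟨C', hs', ht⟩ := h' F hF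
    obtain ⟨n, hn, hn'⟩ := (hs.and hs').exists
    have hC : C = C' := hn.symm.trans hn'
    exact ⟨C, hr, hC ▸ ht⟩

/-- Edge-equivalence of rays, as a setoid. -/
def rayEdgeSetoid (G : SimpleGraph V) : Setoid G.Ray := ⟨G.EdgeEquiv, G.edgeEquiv_equivalence⟩

/-- The edge-ends of `G`: the classes of edge-equivalent rays. -/
def EdgeEnd (G : SimpleGraph V) : Type _ := Quotient G.rayEdgeSetoid

/-- The edge-end to which a ray belongs. -/
def Ray.edgeEnd {G : SimpleGraph V} (r : G.Ray) : G.EdgeEnd := Quotient.mk G.rayEdgeSetoid r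

/-- The edge-end `ω` lives in the set of vertices `C`: every ray in `ω` has a tail in `C`.
If `C` is the vertex set of a component of `G - F` with `F` finite, this says that `C` is the
component `C(F, ω)`. -/
def EdgeEnd.LivesIn {G : SimpleGraph V} (ω : G.EdgeEnd) (C : Set V) : Prop :=
  ∀ r : G.Ray, r.edgeEnd = ω → r.HasTailIn C

/-- The vertex `v` edge-dominates `ω` if for every finite set `F` of edges, `ω` lives in the
component of `G - F` that contains `v`. -/
def EdgeDominates (G : SimpleGraph V) (v : V) (ω : G.EdgeEnd) : Prop :=
  ∀ F : Set (Sym2 V), F.Finite → ω.LivesIn ((G.deleteEdges F).connectedComponentMk v).supp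

/-- An edge-end is dominated if some vertex edge-dominates it. -/
def EdgeEnd.IsDominated {G : SimpleGraph V} (ω : G.EdgeEnd) : Prop :=
  ∃ v, G.EdgeDominates v ω

/-- The set `E_G(A, B)` of the edges of `G` between `A` and `B`. -/
def edgesBetween (G : SimpleGraph V) (A B : Set V) : Set (Sym2 V) :=
  {e | ∃ x ∈ A, ∃ y ∈ B, G.Adj x y ∧ e = s(x, y)}

/-- (The vertex set of) a region: a connected subgraph with only finitely many edges between it
and its complement. -/
def IsRegion (G : SimpleGraph V) (C : Set V) : Prop :=
  (G.induce C).Connected ∧ (G.edgesBetween C Cᶜ).Finite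

/-- The topology of the edge-end space: the sets of all edge-ends living in a given region form a
basis. -/
instance (G : SimpleGraph V) : TopologicalSpace G.EdgeEnd :=
  TopologicalSpace.generateFrom {U | ∃ C, G.IsRegion C ∧ U = {ω | ω.LivesIn C}}

/-- The set `‖G‖` of all vertices and edge-ends of `G`. -/
inductive VertexOrEdgeEnd (G : SimpleGraph V)
  | vertex (v : V)
  | edgeEnd (ω : G.EdgeEnd)

/-- The set `‖C‖` that consists of the vertices in `C` and of the edge-ends living in `C`. -/
def VertexOrEdgeEnd.within (G : SimpleGraph V) (C : Set V) : Set G.VertexOrEdgeEnd :=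
  vertex '' C ∪ edgeEnd '' {ω | ω.LivesIn C}

/-- The topology of `‖G‖`: the sets `‖C‖` with `C` a region form a basis. -/
instance (G : SimpleGraph V) : TopologicalSpace G.VertexOrEdgeEnd :=
  TopologicalSpace.generateFrom {U | ∃ C, G.IsRegion C ∧ U = VertexOrEdgeEnd.within G C}

/-- Two vertices are related if they are not finitely separable, that is, if no finite set of
edges separates them. -/
def edgeBlockSetoid (G : SimpleGraph V) : Setoid V where
  r x y := ∀ F : Set (Sym2 V), F.Finite → (G.deleteEdges F).Reachable x y
  iseqv :=
    { refl := fun _ _ _ => Reachable.rfl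
      symm := fun h F hF => (h F hF).symm
      trans := fun h h' F hF => (h F hF).trans (h' F hF) }

/-- The `ω`-edge-blocks of `G`. -/
def omegaEdgeBlocks (G : SimpleGraph V) : Set (Set V) := G.edgeBlockSetoid.classes

/-- A tree-cut decomposition of `G`: a tree and a partition of the vertex set of `G` into
non-empty parts that are indexed by the nodes of the tree. -/
structure TreeCutDecomposition (G : SimpleGraph V) (N : Type*) where
  /-- The decomposition tree. -/
  tree : SimpleGraph N
  isTree : tree.IsTree
  /-- The parts. -/
  part : N → Set V
  part_nonempty : ∀ t, (part t).Nonempty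
  part_disjoint : Pairwise fun s t => Disjoint (part s) (part t)
  iUnion_part : ⋃ t, part t = univ

namespace TreeCutDecomposition

variable {N : Type*} {G : SimpleGraph V} (D : TreeCutDecomposition G N)

/-- For an edge `t₁t₂` of the tree, the component of the tree minus this edge that
contains `t₁`. -/
def side (t₁ t₂ : N) : Set N :=
  ((D.tree.deleteEdges {s(t₁, t₂)}).connectedComponentMk t₁).supp

/-- The union of all parts that belong to nodes in `S`. -/
def unionParts (S : Set N) : Set V := ⋃ t ∈ S, D.part t

/-- The adhesion set of the edge `t₁t₂` of the tree. -/
def adhesion (t₁ t₂ : N) : Set (Sym2 V) :=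
  G.edgesBetween (D.unionParts (D.side t₁ t₂)) (D.unionParts (D.side t₂ t₁))

/-- All adhesion sets are finite. -/
def FiniteAdhesion : Prop := ∀ t₁ t₂, D.tree.Adj t₁ t₂ → (D.adhesion t₁ t₂).Finite

/-- The edge-end `ω` orients every edge `t₁t₂` of the tree towards the component of the tree minus
this edge over which `ω` lives. All edges point towards the node or end `x` of the tree if `x`
always lies on the side so chosen. -/
def PointsTo (ω : G.EdgeEnd) (x : D.tree.VertexOrEdgeEnd) : Prop :=
  ∀ t₁ t₂, D.tree.Adj t₁ t₂ → ω.LivesIn (D.unionParts (D.side t₁ t₂)) →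
    x ∈ VertexOrEdgeEnd.within D.tree (D.side t₁ t₂)

end TreeCutDecomposition

end SimpleGraph

/-! The core is a dictionary between finite cuts. If only finitely many edges of `T` leave `S`, then
an edge of `G` leaving the union of the parts over `S` lies in the adhesion set of one of these tree
edges, so finite adhesion makes the cut in `G` finite (`FiniteAdhesion.finiteCut_unionParts`).
Conversely, a finite cut of `G` splits no edge-block, so its side `A` is a union of parts over some
`S`; every tree edge leaving `S` is witnessed by an edge of `G` leaving `A`, and distinct tree edges
have distinct witnesses (`exists_eq_unionParts`).

The topologies of `G.EdgeEnd` and of `‖T‖` are both generated by finite cuts, connected or not. If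
all edges point towards `x`, then `x ∈ ‖S‖` exactly if `ω` lives over `S`, for every finite cut `S`
of `T` (`PointsTo.mem_within_iff`). Hence `φ` is inducing. It is well defined and injective because
finite cuts separate the points of `‖T‖` and the edge-ends of `G`. The same dictionary shows that a
vertex in `X_t` edge-dominates `ω` exactly if `φ ω = t`.

Two existence statements remain. Some `x` exists because following the orientation from node to node
either stops at a sink or traces a ray of `T`. Every end of `T` is hit because, in the connected
graph `G`, vertices chosen from the parts along a ray of `T` can be linked up to a ray of `G` that
follows it (`Connected.exists_ray_of_finiteCuts`). -/

namespace SimpleGraph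

/-! ### Finite cuts, and the topologies they generate -/

section FiniteCuts

variable {V : Type*} {G : SimpleGraph V}

/-- A set of vertices that contains one end of an edge whenever it contains the other is a union
of components. -/
theorem Reachable.mem_of_closed {S : Set V} (hS : ∀ u v, G.Adj u v → u ∈ S → v ∈ S) {x y : V}
    (h : G.Reachable x y) (hx : x ∈ S) : y ∈ S := by
  obtain ⟨p⟩ := h
  induction p with
  | nil => exact hx
  | cons hadj _ ih => exact ih (hS _ _ hadj hx)

theorem edgesBetween_comm (A B : Set V) : G.edgesBetween A B = G.edgesBetween B A := by
  ext e
  constructor <;> rintro ⟨x, hx, y, hy, hxy, rfl⟩ <;> exact ⟨y, hy, x, hx, hxy.symm, Sym2.eq_swap⟩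

/-- Only finitely many edges leave the set `A`. -/
def FiniteCut (G : SimpleGraph V) (A : Set V) : Prop := (G.edgesBetween A Aᶜ).Finite

theorem FiniteCut.compl {A : Set V} (h : G.FiniteCut A) : G.FiniteCut Aᶜ := by
  rw [FiniteCut, compl_compl, edgesBetween_comm]
  exact h

theorem mem_of_reachable_deleteEdges {A : Set V} {F : Set (Sym2 V)}
    (hF : G.edgesBetween A Aᶜ ⊆ F) {x y : V} (h : (G.deleteEdges F).Reachable x y) (hx : x ∈ A) :
    y ∈ A := by
  refine h.mem_of_closed (fun u v huv hu => ?_) hx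
  by_contra hv
  rw [deleteEdges_adj] at huv
  exact huv.2 (hF ⟨u, hu, v, hv, huv.1, rfl⟩)

theorem mem_supp_mk {H : SimpleGraph V} {x y : V} :
    y ∈ (H.connectedComponentMk x).supp ↔ H.Reachable x y := by
  rw [ConnectedComponent.mem_supp_iff, ConnectedComponent.eq]
  exact ⟨Reachable.symm, Reachable.symm⟩

theorem edgesBetween_supp_subset (F : Set (Sym2 V)) (K : (G.deleteEdges F).ConnectedComponent) :
    G.edgesBetween K.supp K.suppᶜ ⊆ F := by
  rintro e ⟨x, hx, y, hy, hxy, rfl⟩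
  by_contra he
  have hadj : (G.deleteEdges F).Adj x y := deleteEdges_adj.2 ⟨hxy, he⟩
  exact hy ((ConnectedComponent.sound hadj.symm.reachable).trans hx)

theorem finiteCut_supp {F : Set (Sym2 V)} (hF : F.Finite)
    (K : (G.deleteEdges F).ConnectedComponent) : G.FiniteCut K.supp :=
  hF.subset (edgesBetween_supp_subset F K)

theorem isRegion_supp {F : Set (Sym2 V)} (hF : F.Finite)
    (K : (G.deleteEdges F).ConnectedComponent) : G.IsRegion K.supp :=
  ⟨K.connected_toSimpleGraph.mono (fun _ _ h => (deleteEdges_le F) h), finiteCut_supp hF K⟩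

theorem supp_subset_of_mem {A : Set V} {F : Set (Sym2 V)} (hF : G.edgesBetween A Aᶜ ⊆ F)
    {K : (G.deleteEdges F).ConnectedComponent} {x : V} (hx : x ∈ K.supp) (hA : x ∈ A) :
    K.supp ⊆ A := fun _ hy =>
  mem_of_reachable_deleteEdges hF (ConnectedComponent.exact (hx.trans hy.symm)) hA

theorem Ray.HasTailIn.mono {r : G.Ray} {A B : Set V} (h : r.HasTailIn A) (hAB : A ⊆ B) :
    r.HasTailIn B := Eventually.mono h fun _ hn => hAB hn

theorem EdgeEnd.LivesIn.mono {ω : G.EdgeEnd} {A B : Set V} (h : ω.LivesIn A) (hAB : A ⊆ B) :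
    ω.LivesIn B := fun r hr => (h r hr).mono hAB

theorem EdgeEnd.exists_ray (ω : G.EdgeEnd) : ∃ r : G.Ray, r.edgeEnd = ω := Quotient.exists_rep ω

theorem Ray.edgeEnd_eq_iff {r s : G.Ray} : r.edgeEnd = s.edgeEnd ↔ G.EdgeEquiv r s :=
  Quotient.eq (r := G.rayEdgeSetoid)

/-- Equivalent rays share a component of `G` minus the finite cut of `A`, and such a component does
not cross `A`; so one ray decides for all. -/
theorem Ray.livesIn_edgeEnd_iff {r : G.Ray} {A : Set V} (hA : G.FiniteCut A) :
    r.edgeEnd.LivesIn A ↔ r.HasTailIn A := by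
  refine ⟨fun h => h r rfl, fun h s hs => ?_⟩
  obtain ⟨K, hsK, hrK⟩ := Ray.edgeEnd_eq_iff.1 hs _ hA
  obtain ⟨n, hn, hn'⟩ := (h.and hrK).exists
  exact hsK.mono (supp_subset_of_mem subset_rfl hn' hn)

theorem EdgeEnd.exists_component (ω : G.EdgeEnd) {F : Set (Sym2 V)} (hF : F.Finite) :
    ∃ K : (G.deleteEdges F).ConnectedComponent, ω.LivesIn K.supp := by
  obtain ⟨r, rfl⟩ := ω.exists_ray
  obtain ⟨K, hK⟩ := r.exists_component hF
  exact ⟨K, (Ray.livesIn_edgeEnd_iff (finiteCut_supp hF K)).2 hK⟩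

theorem EdgeEnd.LivesIn.inter_nonempty {ω : G.EdgeEnd} {A B : Set V} (hA : ω.LivesIn A)
    (hB : ω.LivesIn B) : (A ∩ B).Nonempty := by
  obtain ⟨r, rfl⟩ := ω.exists_ray
  obtain ⟨n, hn⟩ := ((hA r rfl).and (hB r rfl)).exists
  exact ⟨_, hn⟩

theorem EdgeEnd.livesIn_or_compl (ω : G.EdgeEnd) {A : Set V} (hA : G.FiniteCut A) :
    ω.LivesIn A ∨ ω.LivesIn Aᶜ := by
  obtain ⟨K, hK⟩ := ω.exists_component hA
  obtain ⟨x, hx, -⟩ := hK.inter_nonempty hK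
  by_cases hxA : x ∈ A
  · exact .inl (hK.mono (supp_subset_of_mem subset_rfl hx hxA))
  · refine .inr (hK.mono (supp_subset_of_mem ?_ hx hxA))
    rw [compl_compl, edgesBetween_comm]

theorem EdgeEnd.livesIn_compl_iff (ω : G.EdgeEnd) {A : Set V} (hA : G.FiniteCut A) :
    ω.LivesIn Aᶜ ↔ ¬ ω.LivesIn A := by
  refine ⟨fun h h' => ?_, (ω.livesIn_or_compl hA).resolve_left⟩
  obtain ⟨x, hx, hx'⟩ := h.inter_nonempty h'
  exact hx hx'

/-- Distinct edge-ends are separated by a finite cut. -/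
theorem EdgeEnd.exists_finiteCut_of_ne {ω ω' : G.EdgeEnd} (h : ω ≠ ω') :
    ∃ A, G.FiniteCut A ∧ ω.LivesIn A ∧ ¬ ω'.LivesIn A := by
  by_contra! hcon
  obtain ⟨r, rfl⟩ := ω.exists_ray
  obtain ⟨s, rfl⟩ := ω'.exists_ray
  refine h (Ray.edgeEnd_eq_iff.2 fun F hF => ?_)
  obtain ⟨K, hK⟩ := r.exists_component hF
  have hcut := finiteCut_supp hF K
  exact ⟨K, hK, hcon _ hcut ((Ray.livesIn_edgeEnd_iff hcut).2 hK) s rfl⟩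

open VertexOrEdgeEnd in
@[simp]
theorem VertexOrEdgeEnd.vertex_mem_within {v : V} {A : Set V} :
    (vertex v : G.VertexOrEdgeEnd) ∈ within G A ↔ v ∈ A := by
  simp [within]

open VertexOrEdgeEnd in
@[simp]
theorem VertexOrEdgeEnd.edgeEnd_mem_within {ω : G.EdgeEnd} {A : Set V} :
    (edgeEnd ω : G.VertexOrEdgeEnd) ∈ within G A ↔ ω.LivesIn A := by
  simp [within]

theorem VertexOrEdgeEnd.within_mono {A B : Set V} (h : A ⊆ B) : within G A ⊆ within G B := by
  rintro (v | ω) hx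
  · exact vertex_mem_within.2 (h (vertex_mem_within.1 hx))
  · exact edgeEnd_mem_within.2 ((edgeEnd_mem_within.1 hx).mono h)

theorem VertexOrEdgeEnd.mem_within_compl_iff (x : G.VertexOrEdgeEnd) {A : Set V}
    (hA : G.FiniteCut A) : x ∈ within G Aᶜ ↔ x ∉ within G A := by
  cases x with
  | vertex v => simp
  | edgeEnd ω => simp [ω.livesIn_compl_iff hA]

theorem VertexOrEdgeEnd.exists_component (x : G.VertexOrEdgeEnd) {F : Set (Sym2 V)}
    (hF : F.Finite) : ∃ K : (G.deleteEdges F).ConnectedComponent, x ∈ within G K.supp := by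
  cases x with
  | vertex v =>
    exact ⟨connectedComponentMk _ v,
      vertex_mem_within.2 ConnectedComponent.connectedComponentMk_mem⟩
  | edgeEnd ω => exact (ω.exists_component hF).imp fun _ h => edgeEnd_mem_within.2 h

theorem VertexOrEdgeEnd.inter_nonempty {x : G.VertexOrEdgeEnd} {A B : Set V}
    (hA : x ∈ within G A) (hB : x ∈ within G B) : (A ∩ B).Nonempty := by
  cases x with
  | vertex v => exact ⟨v, vertex_mem_within.1 hA, vertex_mem_within.1 hB⟩
  | edgeEnd ω => exact (edgeEnd_mem_within.1 hA).inter_nonempty (edgeEnd_mem_within.1 hB)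

/-- If `x` lies in `‖A‖` and in each of finitely many sets `‖B i‖`, then these sets have a common
vertex. -/
theorem VertexOrEdgeEnd.exists_mem_of_finite {ι : Type*} {I : Set ι} (hI : I.Finite)
    {x : G.VertexOrEdgeEnd} {A : Set V} {B : ι → Set V} (hA : x ∈ within G A)
    (hB : ∀ i ∈ I, x ∈ within G (B i)) : ∃ v ∈ A, ∀ i ∈ I, v ∈ B i := by
  cases x with
  | vertex v =>
    exact ⟨v, vertex_mem_within.1 hA, fun i hi => vertex_mem_within.1 (hB i hi)⟩
  | edgeEnd ω =>
    obtain ⟨r, rfl⟩ := ω.exists_ray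
    have h1 : ∀ᶠ n in atTop, r.toFun n ∈ A := edgeEnd_mem_within.1 hA r rfl
    have h2 : ∀ᶠ n in atTop, ∀ i ∈ I, r.toFun n ∈ B i :=
      (eventually_all_finite hI).2 fun i hi => edgeEnd_mem_within.1 (hB i hi) r rfl
    obtain ⟨n, hn, hn'⟩ := (h1.and h2).exists
    exact ⟨_, hn, hn'⟩

/-- The set `A` may be disconnected, but the component of `G` minus its cut in which `ω` lives is a
region inside `A`. -/
theorem EdgeEnd.isOpen_livesIn {A : Set V} (hA : G.FiniteCut A) :
    IsOpen {ω : G.EdgeEnd | ω.LivesIn A} := by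
  rw [isOpen_iff_forall_mem_open]
  intro ω hω
  obtain ⟨K, hK⟩ := ω.exists_component hA
  obtain ⟨x, hx, hxA⟩ := hK.inter_nonempty hω
  exact ⟨_, fun ω' hω' => hω'.mono (supp_subset_of_mem subset_rfl hx hxA),
    .basic _ ⟨_, isRegion_supp hA K, rfl⟩, hK⟩

theorem VertexOrEdgeEnd.isOpen_within {A : Set V} (hA : G.FiniteCut A) :
    IsOpen (within G A) := by
  rw [isOpen_iff_forall_mem_open]
  intro x hx
  obtain ⟨K, hK⟩ := x.exists_component hA
  obtain ⟨v, hv, hvA⟩ := inter_nonempty hK hx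
  exact ⟨_, within_mono (supp_subset_of_mem subset_rfl hv hvA),
    .basic _ ⟨_, isRegion_supp hA K, rfl⟩, hK⟩

/-- Unlike regions, finite cuts are closed under complement and require no connectedness, so they
can be carried back and forth between `G` and the tree. -/
theorem EdgeEnd.topology_eq_generateFrom_finiteCut (G : SimpleGraph V) :
    (inferInstance : TopologicalSpace G.EdgeEnd) =
      TopologicalSpace.generateFrom {U | ∃ A, G.FiniteCut A ∧ U = {ω | ω.LivesIn A}} := by
  refine le_antisymm (le_generateFrom ?_) (TopologicalSpace.generateFrom_anti ?_)
  · rintro U ⟨A, hA, rfl⟩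
    exact isOpen_livesIn hA
  · rintro U ⟨A, hA, rfl⟩
    exact ⟨A, hA.2, rfl⟩

theorem VertexOrEdgeEnd.topology_eq_generateFrom_finiteCut (G : SimpleGraph V) :
    (inferInstance : TopologicalSpace G.VertexOrEdgeEnd) =
      TopologicalSpace.generateFrom {U | ∃ A, G.FiniteCut A ∧ U = within G A} := by
  refine le_antisymm (le_generateFrom ?_) (TopologicalSpace.generateFrom_anti ?_)
  · rintro U ⟨A, hA, rfl⟩
    exact isOpen_within hA
  · rintro U ⟨A, hA, rfl⟩
    exact ⟨A, hA.2, rfl⟩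

theorem edgeDominates_iff {v : V} {ω : G.EdgeEnd} :
    G.EdgeDominates v ω ↔ ∀ A, G.FiniteCut A → v ∈ A → ω.LivesIn A := by
  constructor
  · intro h A hA hv
    exact (h _ hA).mono
      (supp_subset_of_mem subset_rfl ConnectedComponent.connectedComponentMk_mem hv)
  · intro h F hF
    exact h _ (finiteCut_supp hF _) ConnectedComponent.connectedComponentMk_mem

/-- Orienting the cut edges away from `A` loses nothing, and ordered pairs are easier to index and
map. -/
theorem finiteCut_iff_finite_pairs {A : Set V} :
    G.FiniteCut A ↔ {p : V × V | p.1 ∈ A ∧ p.2 ∉ A ∧ G.Adj p.1 p.2}.Finite := by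
  have himage : G.edgesBetween A Aᶜ =
      (fun p : V × V => s(p.1, p.2)) '' {p : V × V | p.1 ∈ A ∧ p.2 ∉ A ∧ G.Adj p.1 p.2} := by
    ext e
    constructor
    · rintro ⟨x, hx, y, hy, hxy, rfl⟩
      exact ⟨(x, y), ⟨hx, hy, hxy⟩, rfl⟩
    · rintro ⟨⟨x, y⟩, ⟨hx, hy, hxy⟩, rfl⟩
      exact ⟨x, hx, y, hy, hxy, rfl⟩
  rw [FiniteCut, himage, finite_image_iff]
  rintro ⟨a, b⟩ ⟨ha, hb, -⟩ ⟨c, d⟩ ⟨hc, hd, -⟩ h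
  rcases Sym2.eq_iff.1 h with ⟨h1, h2⟩ | ⟨h1, -⟩
  · exact Prod.ext h1 h2
  · exact absurd (h1 ▸ ha) hd

/-- A connected graph minus finitely many edges has only finitely many components. -/
theorem Connected.finite_connectedComponent_deleteEdges (hG : G.Connected) {F : Set (Sym2 V)}
    (hF : F.Finite) : Finite (G.deleteEdges F).ConnectedComponent := by
  obtain ⟨v₀⟩ := hG.nonempty
  have hE : {v : V | ∃ e ∈ F, v ∈ e}.Finite := by
    have : {v : V | ∃ e ∈ F, v ∈ e} = ⋃ e ∈ F, {v | v ∈ e} := by ext; simp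
    rw [this]
    refine hF.biUnion fun e _ => ?_
    induction e with
    | h x y =>
      refine (Set.toFinite {x, y}).subset fun v hv => ?_
      simpa using hv
  refine Set.finite_univ_iff.1 (((hE.insert v₀).image
    (G.deleteEdges F).connectedComponentMk).subset fun K _ => ?_)
  -- A component that meets no edge of `F` is closed under adjacency in `G`, hence contains `v₀`.
  by_cases h : ∃ v ∈ K.supp, ∃ e ∈ F, v ∈ e
  · obtain ⟨v, hv, he⟩ := h
    exact ⟨v, .inr he, hv⟩
  · push Not at h
    obtain ⟨x, hx⟩ := K.nonempty_supp
    refine ⟨v₀, .inl rfl, (hG.preconnected x v₀).mem_of_closed (S := K.supp)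
      (fun u v huv hu => ?_) hx⟩
    have hadj : (G.deleteEdges F).Adj u v :=
      deleteEdges_adj.2 ⟨huv, fun he => h u hu _ he (Sym2.mem_mk_left u v)⟩
    exact (ConnectedComponent.sound hadj.symm.reachable).trans hu

end FiniteCuts

/-! ### Sides of tree edges, and the correspondence between cuts of the tree and cuts of the graph
-/

theorem IsAcyclic.not_reachable_of_mem_edges {N : Type*} {T : SimpleGraph N} (hT : T.IsAcyclic)
    {p q a b : N} {w : T.Walk p q} (hw : w.IsPath) (h : s(a, b) ∈ w.edges) :
    ¬ (T.deleteEdges {s(a, b)}).Reachable p q := by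
  classical
  rw [reachable_deleteEdges_iff_exists_walk]
  rintro ⟨w', hw'⟩
  have := (hT.subsingleton_path p q).elim ⟨w, hw⟩ w'.toPath
  have hwe : w = w'.toPath := congrArg Subtype.val this
  rw [hwe] at h
  exact hw' (w'.edges_toPath_subset_edges h)

namespace TreeCutDecomposition

variable {V N : Type*} {G : SimpleGraph V} (D : G.TreeCutDecomposition N)

theorem mem_side {a b t : N} :
    t ∈ D.side a b ↔ (D.tree.deleteEdges {s(a, b)}).Reachable a t := mem_supp_mk

theorem left_mem_side (a b : N) : a ∈ D.side a b := D.mem_side.2 Reachable.rfl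

theorem eq_of_adj_of_mem_side {a b y z : N} (hyz : D.tree.Adj y z) (hy : y ∈ D.side a b)
    (hz : z ∉ D.side a b) : y = a ∧ z = b := by
  by_cases h : s(y, z) = s(a, b)
  · rcases Sym2.eq_iff.1 h with h | ⟨-, rfl⟩
    · exact h
    · exact absurd (D.left_mem_side _ _) hz
  · have hadj : (D.tree.deleteEdges {s(a, b)}).Adj y z := deleteEdges_adj.2 ⟨hyz, h⟩
    exact absurd (D.mem_side.2 ((D.mem_side.1 hy).trans hadj.reachable)) hz

theorem disjoint_side {a b : N} (hab : D.tree.Adj a b) : Disjoint (D.side a b) (D.side b a) := by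
  rw [Set.disjoint_left]
  intro t h1 h2
  rw [mem_side] at h1 h2
  rw [Sym2.eq_swap] at h2
  exact isBridge_iff.1 (isAcyclic_iff_forall_adj_isBridge.1 D.isTree.isAcyclic hab)
    (h1.trans h2.symm)

theorem side_swap {a b : N} (hab : D.tree.Adj a b) : D.side b a = (D.side a b)ᶜ := by
  refine Subset.antisymm (D.disjoint_side hab).subset_compl_left fun t ht => ?_
  refine ((D.isTree.connected.preconnected a t).mem_of_closed (S := D.side a b ∪ D.side b a)
    (fun u v huv hu => ?_) (.inl (D.left_mem_side a b))).resolve_left ht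
  by_contra hv
  rw [mem_union, not_or] at hv
  rcases hu with hu | hu
  · exact hv.2 ((D.eq_of_adj_of_mem_side huv hu hv.1).2 ▸ D.left_mem_side b a)
  · exact hv.1 ((D.eq_of_adj_of_mem_side huv hu hv.2).2 ▸ D.left_mem_side a b)

theorem right_notMem_side {a b : N} (hab : D.tree.Adj a b) : b ∉ D.side a b := by
  have := D.left_mem_side b a
  rwa [D.side_swap hab] at this

theorem finiteCut_side (a b : N) : D.tree.FiniteCut (D.side a b) :=
  finiteCut_supp (finite_singleton _) _

/-- A walk inside `side a b` could leave `side u t` only through the edge `ut`, and so only by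
reaching `t`. -/
theorem side_subset_side {a b u t : N} (ha : a ∈ D.side u t) (ht : t ∉ D.side a b) :
    D.side a b ⊆ D.side u t := by
  intro x hx
  refine ((D.mem_side.1 hx).mem_of_closed (S := D.side a b ∩ D.side u t)
    (fun y z hyz hy => ?_) ⟨D.left_mem_side a b, ha⟩).2
  have hz : z ∈ D.side a b := D.mem_side.2 ((D.mem_side.1 hy.1).trans hyz.reachable)
  refine ⟨hz, ?_⟩
  by_contra hz'
  exact ht ((D.eq_of_adj_of_mem_side (deleteEdges_le _ hyz) hy.2 hz').2 ▸ hz)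

/-- Some edge at `t` separates `t` from a given other node. -/
theorem exists_adj_mem_side {t a : N} (h : t ≠ a) : ∃ u, D.tree.Adj u t ∧ a ∈ D.side u t := by
  classical
  obtain ⟨w, hw⟩ := (D.isTree.connected.preconnected t a).exists_isPath
  cases w with
  | nil => exact absurd rfl h
  | cons hadj w =>
    refine ⟨_, hadj.symm, D.mem_side.2 (reachable_deleteEdges_iff_exists_walk.2 ⟨w, fun he => ?_⟩)⟩
    exact ((Walk.cons_isPath_iff _ _).1 hw).2 (w.snd_mem_support_of_mem_edges he)

/-- Two nodes on different sides of a set of nodes are separated by an edge that leaves this set. -/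
theorem exists_adj_side_of_mem_of_notMem {S : Set N} {p q : N} (hp : p ∈ S) (hq : q ∉ S) :
    ∃ u ∈ S, ∃ v ∉ S, D.tree.Adj u v ∧ (p ∈ D.side u v ↔ q ∈ D.side v u) := by
  obtain ⟨w, hw⟩ := (D.isTree.connected.preconnected p q).exists_isPath
  -- The path uses this edge, so its ends lie on different sides; which end lies on which side is
  -- never needed.
  obtain ⟨d, hd, hd1, hd2⟩ := w.exists_boundary_dart S hp hq
  refine ⟨d.fst, hd1, d.snd, hd2, d.adj, ?_⟩
  have hsep := D.isTree.isAcyclic.not_reachable_of_mem_edges hw (a := d.fst) (b := d.snd)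
    (List.mem_map.2 ⟨d, hd, rfl⟩)
  constructor
  · intro h
    rw [D.side_swap d.adj]
    exact fun h' => hsep ((D.mem_side.1 h).symm.trans (D.mem_side.1 h'))
  · intro h
    by_contra h'
    rw [← mem_compl_iff, ← D.side_swap d.adj, mem_side] at h'
    rw [mem_side] at h
    rw [Sym2.eq_swap] at h h'
    exact hsep (h'.symm.trans h)

theorem mem_unionParts {S : Set N} {x : V} : x ∈ D.unionParts S ↔ ∃ t ∈ S, x ∈ D.part t := by
  simp [unionParts]

theorem exists_mem_part (x : V) : ∃ t, x ∈ D.part t :=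
  mem_iUnion.1 (D.iUnion_part ▸ mem_univ x)

theorem eq_of_mem_part {x : V} {s t : N} (hs : x ∈ D.part s) (ht : x ∈ D.part t) : s = t := by
  by_contra h
  exact Set.disjoint_left.1 (D.part_disjoint h) hs ht

theorem mem_unionParts_iff_of_mem_part {S : Set N} {x : V} {t : N} (ht : x ∈ D.part t) :
    x ∈ D.unionParts S ↔ t ∈ S := by
  rw [mem_unionParts]
  exact ⟨fun ⟨s, hs, hx⟩ => D.eq_of_mem_part hx ht ▸ hs, fun h => ⟨t, h, ht⟩⟩

theorem unionParts_mono {S S' : Set N} (h : S ⊆ S') : D.unionParts S ⊆ D.unionParts S' :=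
  biUnion_subset_biUnion_left h

theorem unionParts_compl (S : Set N) : D.unionParts Sᶜ = (D.unionParts S)ᶜ := by
  ext x
  obtain ⟨t, ht⟩ := D.exists_mem_part x
  rw [mem_compl_iff, D.mem_unionParts_iff_of_mem_part ht, D.mem_unionParts_iff_of_mem_part ht,
    mem_compl_iff]

variable {D}

/-- For an edge `xy` of `G` leaving the union, the tree path between the nodes of `x` and `y` leaves
`S` through some tree edge, and `xy` lies in the adhesion set of that edge. -/
theorem FiniteAdhesion.finiteCut_unionParts (hfin : D.FiniteAdhesion) {S : Set N}
    (hS : D.tree.FiniteCut S) : G.FiniteCut (D.unionParts S) := by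
  rw [finiteCut_iff_finite_pairs] at hS
  refine (hS.biUnion fun p hp => (hfin p.1 p.2 hp.2.2)).subset ?_
  rintro e ⟨x, hx, y, hy, hxy, rfl⟩
  obtain ⟨p, hp⟩ := D.exists_mem_part x
  obtain ⟨q, hq⟩ := D.exists_mem_part y
  rw [mem_compl_iff, D.mem_unionParts_iff_of_mem_part hq] at hy
  rw [D.mem_unionParts_iff_of_mem_part hp] at hx
  obtain ⟨u, hu, v, hv, huv, hiff⟩ := D.exists_adj_side_of_mem_of_notMem hx hy
  refine mem_biUnion (x := (u, v)) ⟨hu, hv, huv⟩ ?_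
  by_cases h : p ∈ D.side u v
  · exact ⟨x, D.mem_unionParts.2 ⟨p, h, hp⟩, y, D.mem_unionParts.2 ⟨q, hiff.1 h, hq⟩, hxy, rfl⟩
  · have hq' : q ∈ D.side u v := by
      by_contra hq'
      rw [← mem_compl_iff, ← D.side_swap huv] at hq'
      exact h (hiff.2 hq')
    rw [← mem_compl_iff, ← D.side_swap huv] at h
    exact ⟨y, D.mem_unionParts.2 ⟨q, hq', hq⟩, x, D.mem_unionParts.2 ⟨p, h, hp⟩, hxy.symm,
      Sym2.eq_swap⟩

theorem FiniteAdhesion.livesIn_side_swap_iff (hfin : D.FiniteAdhesion) (ω : G.EdgeEnd) {a b : N}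
    (hab : D.tree.Adj a b) :
    ω.LivesIn (D.unionParts (D.side b a)) ↔ ¬ ω.LivesIn (D.unionParts (D.side a b)) := by
  rw [D.side_swap hab, D.unionParts_compl,
    ω.livesIn_compl_iff (hfin.finiteCut_unionParts (D.finiteCut_side a b))]

open VertexOrEdgeEnd

theorem PointsTo.mem_within_side_iff (hfin : D.FiniteAdhesion) {ω : G.EdgeEnd}
    {x : D.tree.VertexOrEdgeEnd} (h : D.PointsTo ω x) {a b : N} (hab : D.tree.Adj a b) :
    x ∈ within D.tree (D.side a b) ↔ ω.LivesIn (D.unionParts (D.side a b)) := by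
  refine ⟨fun hx => ?_, h a b hab⟩
  by_contra hω
  rw [← hfin.livesIn_side_swap_iff ω hab] at hω
  have := h b a hab.symm hω
  rw [D.side_swap hab, x.mem_within_compl_iff (D.finiteCut_side a b)] at this
  exact this hx

/-- If `x` were outside `‖S‖`, one could pick a node `q ∉ S` on the same side as `x` of each of the
finitely many tree edges leaving `S`, and a vertex over a node `p ∈ S` on the side where `ω` lives.
These are the same sides, yet some edge leaving `S` separates `p` from `q`. -/
theorem PointsTo.mem_within_of_livesIn (hfin : D.FiniteAdhesion) {ω : G.EdgeEnd}
    {x : D.tree.VertexOrEdgeEnd} (h : D.PointsTo ω x) {S : Set N} (hS : D.tree.FiniteCut S)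
    (hω : ω.LivesIn (D.unionParts S)) : x ∈ within D.tree S := by
  by_contra hx
  rw [← x.mem_within_compl_iff hS] at hx
  have hP := finiteCut_iff_finite_pairs.1 hS
  set P := {p : N × N | p.1 ∈ S ∧ p.2 ∉ S ∧ D.tree.Adj p.1 p.2}
  -- `B p` is the side of the edge `p` that contains `x`.
  let B : N × N → Set N := fun p => {t | t ∈ D.side p.1 p.2 ↔ x ∈ within D.tree (D.side p.1 p.2)}
  have hB : ∀ p ∈ P, ∃ a b, D.tree.Adj a b ∧ B p = D.side a b ∧
      x ∈ within D.tree (D.side a b) := by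
    rintro ⟨u, v⟩ ⟨-, -, huv⟩
    by_cases hxu : x ∈ within D.tree (D.side u v)
    · exact ⟨u, v, huv, by ext; simp [B, hxu], hxu⟩
    · refine ⟨v, u, huv.symm, ?_, ?_⟩
      · rw [D.side_swap huv]
        ext
        simp [B, hxu]
      · rwa [D.side_swap huv, x.mem_within_compl_iff (D.finiteCut_side u v)]
  obtain ⟨q, hqS, hq⟩ := exists_mem_of_finite hP hx (B := B) fun p hp => by
    obtain ⟨a, b, -, he, hm⟩ := hB p hp
    rwa [he]
  obtain ⟨v, hvS, hv⟩ := exists_mem_of_finite hP (x := edgeEnd ω) (edgeEnd_mem_within.2 hω)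
    (B := fun p => D.unionParts (B p)) fun p hp => by
      obtain ⟨a, b, hab, he, hm⟩ := hB p hp
      rw [he]
      exact edgeEnd_mem_within.2 ((h.mem_within_side_iff hfin hab).1 hm)
  obtain ⟨p, hp⟩ := D.exists_mem_part v
  rw [D.mem_unionParts_iff_of_mem_part hp] at hvS
  obtain ⟨a, ha, b, hb, hab, hiff⟩ := D.exists_adj_side_of_mem_of_notMem hvS hqS
  have h1 := hq (a, b) ⟨ha, hb, hab⟩
  have h2 := (D.mem_unionParts_iff_of_mem_part hp).1 (hv (a, b) ⟨ha, hb, hab⟩)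
  rw [D.side_swap hab, mem_compl_iff] at hiff
  have h3 : p ∈ D.side a b ↔ q ∈ D.side a b := h2.trans h1.symm
  tauto

/-- If all edges point towards `x`, then `x` lies in `‖S‖` exactly if `ω` lives in the union of the
parts indexed by `S`, for every `S` that only finitely many edges leave. -/
theorem PointsTo.mem_within_iff (hfin : D.FiniteAdhesion) {ω : G.EdgeEnd}
    {x : D.tree.VertexOrEdgeEnd} (h : D.PointsTo ω x) {S : Set N} (hS : D.tree.FiniteCut S) :
    x ∈ within D.tree S ↔ ω.LivesIn (D.unionParts S) := by
  refine ⟨fun hx => ?_, h.mem_within_of_livesIn hfin hS⟩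
  by_contra hω
  rw [← ω.livesIn_compl_iff (hfin.finiteCut_unionParts hS), ← D.unionParts_compl] at hω
  exact (x.mem_within_compl_iff hS).1 (h.mem_within_of_livesIn hfin hS.compl hω) hx

/-- No finite cut splits an edge-block, so `A` is a union of parts. Choosing an edge of `G` for each
tree edge leaving `S` maps these tree edges injectively into the finite cut of `A`. -/
theorem exists_eq_unionParts (hblocks : Set.range D.part = G.omegaEdgeBlocks)
    (hadj : ∀ t₁ t₂, D.tree.Adj t₁ t₂ → ∃ x ∈ D.part t₁, ∃ y ∈ D.part t₂, G.Adj x y)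
    {A : Set V} (hA : G.FiniteCut A) : ∃ S, D.tree.FiniteCut S ∧ A = D.unionParts S := by
  have hclosed : ∀ t, ∀ x ∈ D.part t, ∀ y ∈ D.part t, x ∈ A → y ∈ A := by
    intro t x hx y hy hxA
    have ht : D.part t ∈ G.edgeBlockSetoid.classes := by
      have := mem_range_self (f := D.part) t
      rwa [hblocks] at this
    have hxy : G.edgeBlockSetoid x y := G.edgeBlockSetoid.rel_iff_exists_classes.2 ⟨_, ht, hx, hy⟩
    exact mem_of_reachable_deleteEdges subset_rfl (hxy _ hA) hxA
  let S : Set N := {t | (D.part t ∩ A).Nonempty}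
  have hS : A = D.unionParts S := by
    ext x
    obtain ⟨t, ht⟩ := D.exists_mem_part x
    rw [D.mem_unionParts_iff_of_mem_part ht]
    exact ⟨fun hx => ⟨x, ht, hx⟩, fun ⟨y, hy, hyA⟩ => hclosed t y hy x ht hyA⟩
  refine ⟨S, ?_, hS⟩
  rw [finiteCut_iff_finite_pairs] at hA ⊢
  have hex : ∀ p : N × N, ∃ q : V × V, D.tree.Adj p.1 p.2 →
      q.1 ∈ D.part p.1 ∧ q.2 ∈ D.part p.2 ∧ G.Adj q.1 q.2 := by
    rintro ⟨s, t⟩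
    by_cases h : D.tree.Adj s t
    · obtain ⟨x, hx, y, hy, hxy⟩ := hadj s t h
      exact ⟨(x, y), fun _ => ⟨hx, hy, hxy⟩⟩
    · obtain ⟨x, -⟩ := D.part_nonempty s
      exact ⟨(x, x), fun h' => absurd h' h⟩
  choose f hf using hex
  refine Set.Finite.of_finite_image (f := f) (hA.subset ?_) ?_
  · rintro _ ⟨⟨s, t⟩, ⟨hs, ht, hst⟩, rfl⟩
    obtain ⟨h1, h2, h3⟩ := hf (s, t) hst
    rw [hS]
    exact ⟨(D.mem_unionParts_iff_of_mem_part h1).2 hs,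
      fun h => ht ((D.mem_unionParts_iff_of_mem_part h2).1 h), h3⟩
  · rintro p ⟨-, -, hp⟩ q ⟨-, -, hq⟩ hpq
    obtain ⟨h1, h2, -⟩ := hf p hp
    obtain ⟨h3, h4, -⟩ := hf q hq
    rw [← hpq] at h3 h4
    exact Prod.ext (D.eq_of_mem_part h1 h3) (D.eq_of_mem_part h2 h4)

end TreeCutDecomposition

/-! ### Rays of the tree, and the map from edge-ends to nodes and ends -/

namespace TreeCutDecomposition

variable {V N : Type*} {G : SimpleGraph V} (D : G.TreeCutDecomposition N)

theorem antitone_side_of_ne {s : ℕ → N} (hadj : ∀ n, D.tree.Adj (s n) (s (n + 1)))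
    (hne : ∀ n, s (n + 2) ≠ s n) : Antitone fun n => D.side (s (n + 1)) (s n) := by
  refine antitone_nat_of_succ_le fun n => D.side_subset_side ?_ ?_
  · by_contra h
    exact hne n (D.eq_of_adj_of_mem_side (hadj (n + 1)) (D.left_mem_side _ _) h).2
  · intro h
    rw [D.side_swap (hadj (n + 1))] at h
    refine h ?_
    by_contra h'
    exact hne n (D.eq_of_adj_of_mem_side (hadj n).symm (D.left_mem_side _ _) h').2.symm

theorem mem_side_of_lt {s : ℕ → N} (hadj : ∀ n, D.tree.Adj (s n) (s (n + 1)))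
    (hne : ∀ n, s (n + 2) ≠ s n) {n m : ℕ} (h : n < m) : s m ∈ D.side (s (n + 1)) (s n) := by
  obtain ⟨k, rfl⟩ := Nat.exists_eq_succ_of_ne_zero (Nat.ne_zero_of_lt h)
  exact D.antitone_side_of_ne hadj hne (Nat.lt_succ_iff.1 h) (D.left_mem_side _ _)

/-- In a tree, a one-way infinite walk that never turns back is a ray. -/
theorem injective_of_ne {s : ℕ → N} (hadj : ∀ n, D.tree.Adj (s n) (s (n + 1)))
    (hne : ∀ n, s (n + 2) ≠ s n) : Function.Injective s := by
  have hlt : ∀ n m, n < m → s n ≠ s m := fun n m h heq =>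
    D.right_notMem_side (hadj n).symm (heq ▸ D.mem_side_of_lt hadj hne h)
  intro n m h
  by_contra hnm
  exact (Nat.lt_or_gt_of_ne hnm).elim (fun hl => hlt n m hl h) (fun hl => hlt m n hl h.symm)

variable {D}

theorem ray_add_two_ne (r : D.tree.Ray) (n : ℕ) : r.toFun (n + 2) ≠ r.toFun n :=
  r.injective.ne (by omega)

theorem antitone_side_ray (r : D.tree.Ray) :
    Antitone fun n => D.side (r.toFun (n + 1)) (r.toFun n) :=
  D.antitone_side_of_ne r.adj (ray_add_two_ne r)

theorem livesIn_side_ray (r : D.tree.Ray) (n : ℕ) :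
    r.edgeEnd.LivesIn (D.side (r.toFun (n + 1)) (r.toFun n)) := by
  rw [Ray.livesIn_edgeEnd_iff (D.finiteCut_side _ _)]
  filter_upwards [eventually_gt_atTop n] with m hm
  exact D.mem_side_of_lt r.adj (ray_add_two_ne r) hm

/-- A walk from the start of the ray to `v` misses some edge of the ray, so `v` lies on the same
side of that edge as the start; from there on, the sides shrink. -/
theorem eventually_notMem_side_ray (r : D.tree.Ray) (v : N) :
    ∀ᶠ n in atTop, v ∉ D.side (r.toFun (n + 1)) (r.toFun n) := by
  suffices h : ∃ n, v ∉ D.side (r.toFun (n + 1)) (r.toFun n) by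
    obtain ⟨n, hn⟩ := h
    filter_upwards [eventually_ge_atTop n] with m hm h
    exact hn (antitone_side_ray r hm h)
  by_contra! hall
  obtain ⟨w⟩ := D.isTree.connected.preconnected (r.toFun 0) v
  have hfin : {e | e ∈ w.edges}.Finite := w.edges.finite_toSet
  have hinj : Function.Injective fun n => s(r.toFun n, r.toFun (n + 1)) := by
    intro a b hab
    rcases Sym2.eq_iff.1 hab with ⟨h, -⟩ | ⟨h, h'⟩
    · exact r.injective h
    · have h1 := r.injective h
      have h2 := r.injective h'
      omega
  obtain ⟨n, hn⟩ := (hfin.preimage hinj.injOn).exists_notMem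
  have h1 : r.toFun 0 ∉ D.side (r.toFun (n + 1)) (r.toFun n) := by
    rw [D.side_swap (r.adj n), mem_compl_iff, not_not]
    refine D.mem_side.2 (Reachable.symm ?_)
    have : ∀ m ≤ n, (D.tree.deleteEdges {s(r.toFun n, r.toFun (n + 1))}).Reachable
        (r.toFun 0) (r.toFun m) := by
      intro m
      induction m with
      | zero => exact fun _ => Reachable.rfl
      | succ m ih =>
        intro hm
        refine (ih (by omega)).trans (Adj.reachable (deleteEdges_adj.2 ⟨r.adj m, fun h => ?_⟩))
        have := hinj h
        omega
    exact this n le_rfl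
  have h2 : (D.tree.deleteEdges {s(r.toFun (n + 1), r.toFun n)}).Reachable v (r.toFun 0) :=
    (reachable_deleteEdges_iff_exists_walk.2 ⟨w, fun h => hn (by rwa [Sym2.eq_swap] at h)⟩).symm
  exact h1 (D.mem_side.2 ((D.mem_side.1 (hall n)).trans h2))

theorem exists_side_ray_subset {r : D.tree.Ray} {a b : N}
    (h : r.edgeEnd.LivesIn (D.side a b)) :
    ∃ n, D.side (r.toFun (n + 1)) (r.toFun n) ⊆ D.side a b := by
  have h1 : ∀ᶠ n in atTop, r.toFun n ∈ D.side a b := h r rfl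
  obtain ⟨n, hn, hn'⟩ := (((tendsto_add_atTop_nat 1).eventually h1).and
    (eventually_notMem_side_ray r b)).exists
  exact ⟨n, D.side_subset_side hn hn'⟩

open VertexOrEdgeEnd

theorem pointsTo_edgeEnd (hfin : D.FiniteAdhesion) {ω : G.EdgeEnd} {r : D.tree.Ray}
    (h : ∀ n, ω.LivesIn (D.unionParts (D.side (r.toFun (n + 1)) (r.toFun n)))) :
    D.PointsTo ω (edgeEnd r.edgeEnd) := by
  intro a b hab hω
  rw [edgeEnd_mem_within]
  by_contra hr
  rw [← EdgeEnd.livesIn_compl_iff _ (D.finiteCut_side a b), ← D.side_swap hab] at hr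
  obtain ⟨n, hn⟩ := exists_side_ray_subset hr
  exact (hfin.livesIn_side_swap_iff ω hab).1 ((h n).mono (D.unionParts_mono hn)) hω

/-- Checking the edges at `t` suffices: a side that avoids `t` is contained in `side u t` for some
neighbour `u` of `t`. -/
theorem pointsTo_vertex {ω : G.EdgeEnd} {t : N}
    (h : ∀ u, D.tree.Adj u t → ¬ ω.LivesIn (D.unionParts (D.side u t))) :
    D.PointsTo ω (vertex t) := by
  intro a b hab hω
  rw [vertex_mem_within]
  by_contra ht
  obtain ⟨u, hut, ha⟩ := D.exists_adj_mem_side (t := t) (a := a)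
    (fun h => ht (h ▸ D.left_mem_side a b))
  exact h u hut (hω.mono (D.unionParts_mono (D.side_subset_side ha ht)))

theorem exists_pointsTo (hfin : D.FiniteAdhesion) (ω : G.EdgeEnd) : ∃ x, D.PointsTo ω x := by
  by_cases hsink : ∃ t, ∀ u, D.tree.Adj u t → ¬ ω.LivesIn (D.unionParts (D.side u t))
  · obtain ⟨t, ht⟩ := hsink
    exact ⟨_, pointsTo_vertex ht⟩
  push Not at hsink
  choose f hf hω using hsink
  obtain ⟨t₀⟩ := D.isTree.connected.nonempty
  let s : ℕ → N := fun n => f^[n] t₀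
  have hs : ∀ n, s (n + 1) = f (s n) := fun n => Function.iterate_succ_apply' f n t₀
  have hadj : ∀ n, D.tree.Adj (s n) (s (n + 1)) := fun n => hs n ▸ (hf _).symm
  have hlive : ∀ n, ω.LivesIn (D.unionParts (D.side (s (n + 1)) (s n))) := fun n => hs n ▸ hω _
  -- Turning back would mean that `ω` lives on both sides of one edge.
  have hne : ∀ n, s (n + 2) ≠ s n := by
    intro n h
    have := hlive (n + 1)
    rw [h] at this
    exact (hfin.livesIn_side_swap_iff ω (hadj n)).1 (hlive n) this
  exact ⟨_, pointsTo_edgeEnd (r := ⟨s, D.injective_of_ne hadj hne, hadj⟩) hfin hlive⟩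

/-- Distinct points of `‖T‖` are separated by finitely many edges. -/
theorem eq_of_forall_finiteCut {x y : D.tree.VertexOrEdgeEnd}
    (h : ∀ S, D.tree.FiniteCut S → (x ∈ within D.tree S ↔ y ∈ within D.tree S)) : x = y := by
  have hve : ∀ (t : N) (ε : D.tree.EdgeEnd),
      ¬ ∀ S, D.tree.FiniteCut S → (t ∈ S ↔ ε.LivesIn S) := by
    intro t ε h
    obtain ⟨r, rfl⟩ := ε.exists_ray
    obtain ⟨n, hn⟩ := (eventually_notMem_side_ray r t).exists
    exact hn ((h _ (D.finiteCut_side _ _)).2 (livesIn_side_ray r n))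
  cases x with
  | vertex s =>
    cases y with
    | vertex t =>
      by_contra hne
      obtain ⟨u, hut, ht⟩ := D.exists_adj_mem_side (t := s) (a := t) (fun h => hne (h ▸ rfl))
      have := h _ (D.finiteCut_side u s)
      rw [vertex_mem_within, vertex_mem_within] at this
      exact D.right_notMem_side hut (this.2 ht)
    | edgeEnd ε => exact absurd (by simpa using h) (hve s ε)
  | edgeEnd ε =>
    cases y with
    | vertex t =>
      refine absurd (fun S hS => ?_) (hve t ε)
      simpa using (h S hS).symm
    | edgeEnd ε' =>
      by_contra hne
      obtain ⟨S, hS, h1, h2⟩ := EdgeEnd.exists_finiteCut_of_ne (fun h : ε = ε' => hne (h ▸ rfl))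
      exact h2 (by simpa [h1] using h S hS)

theorem PointsTo.unique (hfin : D.FiniteAdhesion) {ω : G.EdgeEnd} {x y : D.tree.VertexOrEdgeEnd}
    (hx : D.PointsTo ω x) (hy : D.PointsTo ω y) : x = y :=
  eq_of_forall_finiteCut fun _ hS =>
    (hx.mem_within_iff hfin hS).trans (hy.mem_within_iff hfin hS).symm

theorem isInducing_of_pointsTo (hfin : D.FiniteAdhesion)
    (hblocks : Set.range D.part = G.omegaEdgeBlocks)
    (hadj : ∀ t₁ t₂, D.tree.Adj t₁ t₂ → ∃ x ∈ D.part t₁, ∃ y ∈ D.part t₂, G.Adj x y)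
    {φ : G.EdgeEnd → D.tree.VertexOrEdgeEnd} (hφ : ∀ ω, D.PointsTo ω (φ ω)) :
    IsInducing φ := by
  have hpre : ∀ S, D.tree.FiniteCut S →
      φ ⁻¹' within D.tree S = {ω | ω.LivesIn (D.unionParts S)} := fun S hS => by
    ext ω
    exact (hφ ω).mem_within_iff hfin hS
  constructor
  refine (EdgeEnd.topology_eq_generateFrom_finiteCut G).trans ?_
  refine Eq.trans ?_ (congrArg (TopologicalSpace.induced φ)
    (topology_eq_generateFrom_finiteCut D.tree)).symm
  rw [induced_generateFrom_eq]
  congr 1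
  ext U
  constructor
  · rintro ⟨A, hA, rfl⟩
    obtain ⟨S, hS, rfl⟩ := exists_eq_unionParts hblocks hadj hA
    exact ⟨_, ⟨S, hS, rfl⟩, hpre S hS⟩
  · rintro ⟨_, ⟨S, hS, rfl⟩, rfl⟩
    exact ⟨_, hfin.finiteCut_unionParts hS, hpre S hS⟩

theorem injective_of_pointsTo (hfin : D.FiniteAdhesion)
    (hblocks : Set.range D.part = G.omegaEdgeBlocks)
    (hadj : ∀ t₁ t₂, D.tree.Adj t₁ t₂ → ∃ x ∈ D.part t₁, ∃ y ∈ D.part t₂, G.Adj x y)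
    {φ : G.EdgeEnd → D.tree.VertexOrEdgeEnd} (hφ : ∀ ω, D.PointsTo ω (φ ω)) :
    Function.Injective φ := by
  intro ω ω' h
  by_contra hne
  obtain ⟨A, hA, h1, h2⟩ := EdgeEnd.exists_finiteCut_of_ne hne
  obtain ⟨S, hS, rfl⟩ := exists_eq_unionParts hblocks hadj hA
  rw [← (hφ ω).mem_within_iff hfin hS] at h1
  rw [← (hφ ω').mem_within_iff hfin hS, ← h] at h2
  exact h2 h1

/-- Domination by `v` means that `ω` lives in every finite-cut side containing `v`. These sides are
the unions of parts over the finite cuts `S` of the tree with `t ∈ S`. -/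
theorem PointsTo.edgeDominates_iff (hfin : D.FiniteAdhesion)
    (hblocks : Set.range D.part = G.omegaEdgeBlocks)
    (hadj : ∀ t₁ t₂, D.tree.Adj t₁ t₂ → ∃ x ∈ D.part t₁, ∃ y ∈ D.part t₂, G.Adj x y)
    {ω : G.EdgeEnd} {x : D.tree.VertexOrEdgeEnd} (h : D.PointsTo ω x) {v : V} {t : N}
    (hv : v ∈ D.part t) : G.EdgeDominates v ω ↔ x = vertex t := by
  rw [SimpleGraph.edgeDominates_iff]
  constructor
  · refine fun hdom => h.unique hfin (pointsTo_vertex fun u hut hω => ?_)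
    exact (hfin.livesIn_side_swap_iff ω hut).1 (hdom _
      (hfin.finiteCut_unionParts (D.finiteCut_side t u))
      ((D.mem_unionParts_iff_of_mem_part hv).2 (D.left_mem_side t u))) hω
  · rintro rfl A hA hvA
    obtain ⟨S, hS, rfl⟩ := exists_eq_unionParts hblocks hadj hA
    rw [D.mem_unionParts_iff_of_mem_part hv] at hvA
    exact (h.mem_within_iff hfin hS).1 (vertex_mem_within.2 hvA)

end TreeCutDecomposition

/-! ### Building rays along shrinking finite cuts -/

section Rays

variable {V : Type*} {G : SimpleGraph V}

/-- A one-way infinite walk that visits every vertex only finitely often contains a ray. -/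
theorem exists_ray_of_locallyFinite_walk {w : ℕ → V} (hadj : ∀ n, G.Adj (w n) (w (n + 1)))
    (hfin : ∀ v, {n | w n = v}.Finite) :
    ∃ (r : G.Ray) (f : ℕ → ℕ), StrictMono f ∧ ∀ n, r.toFun n = w (f n) := by
  have hlast : ∀ n, ∃ m, w m = w n ∧ ∀ l, w l = w n → l ≤ m := fun n => by
    obtain ⟨m, hm, hmax⟩ := (hfin (w n)).exists_le_maximal (a := n) rfl |>.imp fun m h => h.2
    exact ⟨m, hm, fun l hl => (le_total l m).elim id fun h => hmax hl h⟩
  choose last hw hle using hlast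
  -- Loop erasure: step on from the last visit to the current vertex, then jump to the last visit of
  -- the vertex reached.
  let f : ℕ → ℕ := fun n => Nat.rec (last 0) (fun _ m => last (m + 1)) n
  have hf : ∀ n, f (n + 1) = last (f n + 1) := fun _ => rfl
  have hmono : StrictMono f := strictMono_nat_of_lt_succ fun n => by
    rw [hf]
    exact hle (f n + 1) _ rfl
  have hmax : ∀ n l, w l = w (f n) → l ≤ f n := by
    rintro (_ | n) l hl
    · exact hle 0 l (hl.trans (hw 0))
    · rw [hf] at hl ⊢
      exact hle _ l (hl.trans (hw _))
  refine ⟨⟨fun n => w (f n), fun m n h => hmono.injective ?_, fun n => ?_⟩, f, hmono, fun _ => rfl⟩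
  · exact le_antisymm (hmax n _ h) (hmax m _ h.symm)
  · show G.Adj (w (f n)) (w (f (n + 1)))
    rw [hf, hw]
    exact hadj _

/-- Walks that link up a sequence of vertices inside shrinking sets of vertices yield a ray with
tails in all these sets. -/
theorem exists_ray_of_walks {K : ℕ → Set V} (hK : Antitone K) (hinter : ∀ v, ∃ i, v ∉ K i)
    {k : ℕ → V} (hne : ∀ i, k i ≠ k (i + 1))
    (P : ∀ i, G.Walk (k i) (k (i + 1))) (hP : ∀ i, ∀ v ∈ (P i).support, v ∈ K i) :
    ∃ r : G.Ray, ∀ i, r.HasTailIn (K i) := by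
  let Q : ∀ n, G.Walk (k 0) (k n) := fun n => Nat.rec Walk.nil (fun i W => W.append (P i)) n
  have hQ : ∀ n, Q (n + 1) = (Q n).append (P n) := fun _ => rfl
  have hlen : ∀ n, (Q n).length < (Q (n + 1)).length := fun n => by
    rw [hQ, Walk.length_append]
    have : (P n).length ≠ 0 := fun h => hne n (Walk.eq_of_length_eq_zero h)
    omega
  have hlenmono : StrictMono fun n => (Q n).length := strictMono_nat_of_lt_succ hlen
  have hstep : ∀ n m, m ≤ (Q n).length → (Q (n + 1)).getVert m = (Q n).getVert m := by
    intro n m hm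
    rw [hQ, Walk.getVert_append]
    split_ifs with h
    · rfl
    · have : m = (Q n).length := by omega
      subst this
      simp
  have hstable : ∀ n l m, n ≤ l → m ≤ (Q n).length → (Q l).getVert m = (Q n).getVert m := by
    intro n l m hl hm
    induction l, hl using Nat.le_induction with
    | base => rfl
    | succ l hl ih => rw [hstep l m (hm.trans (hlenmono.monotone hl)), ih]
  -- Each `Q n` has length at least `n` and is extended by all later ones, so the diagonal is their
  -- common limit.
  let w : ℕ → V := fun m => (Q m).getVert m
  have hw : ∀ n m, m ≤ (Q n).length → w m = (Q n).getVert m := by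
    intro n m hm
    rcases le_total m n with h | h
    · exact (hstable m n m h (hlenmono.le_apply)).symm
    · exact hstable n m m h hm
  have hadj : ∀ n, G.Adj (w n) (w (n + 1)) := by
    intro n
    have hn : n + 1 ≤ (Q (n + 1)).length := hlenmono.le_apply
    rw [hw (n + 1) n (by omega), hw (n + 1) (n + 1) hn]
    exact Walk.adj_getVert_succ _ (by omega)
  have hmem : ∀ i m, (Q i).length ≤ m → w m ∈ K i := by
    intro i m hm
    have : ∀ n, i ≤ n → ∀ m, (Q i).length ≤ m → m ≤ (Q n).length → (Q n).getVert m ∈ K i := by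
      intro n hn
      induction n, hn using Nat.le_induction with
      | base =>
        intro m h1 _
        rw [Walk.getVert_of_length_le _ h1]
        exact hP i _ (P i).start_mem_support
      | succ n hn ih =>
        intro m h1 h2
        rw [hQ, Walk.getVert_append]
        split_ifs with h
        · exact ih m h1 h.le
        · exact hK hn (hP n _ (Walk.getVert_mem_support _ _))
    have hm' : m ≤ (Q (max i m)).length := (le_max_right i m).trans hlenmono.le_apply
    rw [hw _ _ hm']
    exact this _ (le_max_left _ _) m hm hm'
  have hfin : ∀ v, {n | w n = v}.Finite := by
    intro v
    obtain ⟨i, hi⟩ := hinter v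
    refine (Set.finite_lt_nat (Q i).length).subset fun n hn => ?_
    by_contra h
    exact hi (hn ▸ hmem i n (not_lt.1 h))
  obtain ⟨r, f, hf, hr⟩ := exists_ray_of_locallyFinite_walk hadj hfin
  refine ⟨r, fun i => ?_⟩
  filter_upwards [eventually_ge_atTop (Q i).length] with n hn
  rw [hr]
  exact hmem i _ (hn.trans hf.le_apply)

/-- In a connected graph, a sequence of distinct vertices that converges along a decreasing
sequence of finite cuts with empty intersection gives rise to a ray that does so, too. -/
theorem Connected.exists_ray_of_finiteCuts (hG : G.Connected) {U : ℕ → Set V}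
    (hU : ∀ i, G.FiniteCut (U i)) (hinter : ∀ v, ∃ i, v ∉ U i) {x : ℕ → V}
    (hx : Function.Injective x) (hxU : ∀ i, ∀ᶠ j in atTop, x j ∈ U i) :
    ∃ r : G.Ray, ∀ i, r.HasTailIn (U i) := by
  -- Accumulating the cuts makes `F` monotone, so that the components chosen below are nested.
  let F : ℕ → Set (Sym2 V) := fun i => ⋃ j ∈ Iic i, G.edgesBetween (U j) (U j)ᶜ
  have hF : ∀ i, (F i).Finite := fun i => (Set.finite_Iic i).biUnion fun j _ => hU j
  have hFmono : Monotone F := fun i j h => biUnion_subset_biUnion_left (Iic_subset_Iic.2 h)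
  have hUF : ∀ i, G.edgesBetween (U i) (U i)ᶜ ⊆ F i := fun i =>
    subset_biUnion_of_mem (u := fun j => G.edgesBetween (U j) (U j)ᶜ) (mem_Iic.2 le_rfl)
  -- There are finitely many components, so a nonprincipal ultrafilter selects one of them. Using
  -- the same ultrafilter for all `i` makes any two choices share some `x j`.
  have hcomp : ∀ i, ∃ C : (G.deleteEdges (F i)).ConnectedComponent,
      {j | x j ∈ C.supp} ∈ hyperfilter ℕ := fun i => by
    have := hG.finite_connectedComponent_deleteEdges (hF i)
    obtain ⟨C, hC⟩ := ((hyperfilter ℕ).map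
      fun j => (G.deleteEdges (F i)).connectedComponentMk (x j)).eq_pure_of_finite
    refine ⟨C, ?_⟩
    have hmem : {C} ∈ (hyperfilter ℕ).map
        fun j => (G.deleteEdges (F i)).connectedComponentMk (x j) := by
      rw [hC]
      exact mem_singleton C
    exact hmem
  choose C hC using hcomp
  have hCU : ∀ i, (C i).supp ⊆ U i := fun i => by
    have h : {j | x j ∈ U i} ∈ hyperfilter ℕ :=
      hyperfilter_le_cofinite (Nat.cofinite_eq_atTop ▸ hxU i)
    obtain ⟨j, hj, hj'⟩ := (hyperfilter ℕ).nonempty_of_mem (inter_mem (hC i) h)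
    exact supp_subset_of_mem (hUF i) hj hj'
  have hCanti : Antitone fun i => (C i).supp := fun i l hil => by
    obtain ⟨j, hj, hj'⟩ := (hyperfilter ℕ).nonempty_of_mem (inter_mem (hC i) (hC l))
    exact supp_subset_of_mem ((edgesBetween_supp_subset _ _).trans (hFmono hil)) hj' hj
  have hfreq : ∀ i, ∃ᶠ j in atTop, x j ∈ (C i).supp := fun i => by
    rw [Nat.frequently_atTop_iff_infinite]
    intro hfin
    exact notMem_hyperfilter_of_finite hfin (hC i)
  obtain ⟨g, hg, hgC⟩ := extraction_forall_of_frequently hfreq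
  have hreach : ∀ i, (G.deleteEdges (F i)).Reachable (x (g i)) (x (g (i + 1))) := fun i =>
    ConnectedComponent.exact ((hgC i).trans (hCanti i.le_succ (hgC (i + 1))).symm)
  let P := fun i => Classical.choice (hreach i)
  obtain ⟨r, hr⟩ := exists_ray_of_walks (G := G) hCanti
    (fun v => (hinter v).imp fun i hi h => hi (hCU i h)) (k := fun i => x (g i))
    (fun i => hx.ne (hg.injective.ne (by omega)))
    (fun i => (P i).mapLe (deleteEdges_le _)) (fun i v hv => by
      rw [Walk.support_mapLe_eq_support] at hv
      refine Eq.trans ?_ (hgC i)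
      classical
      exact (ConnectedComponent.sound ((P i).takeUntil v hv).reachable).symm)
  exact ⟨r, fun i => (hr i).mono (hCU i)⟩

end Rays

/-! ### Every end of the tree is attained -/

namespace TreeCutDecomposition

variable {V N : Type*} {G : SimpleGraph V} {D : G.TreeCutDecomposition N}

open VertexOrEdgeEnd

theorem exists_pointsTo_edgeEnd (hG : G.Connected) (hfin : D.FiniteAdhesion)
    (ε : D.tree.EdgeEnd) : ∃ ω : G.EdgeEnd, D.PointsTo ω (edgeEnd ε) := by
  obtain ⟨s, rfl⟩ := ε.exists_ray
  choose x hx using fun n => D.part_nonempty (s.toFun n)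
  have hcut : ∀ i, G.FiniteCut (D.unionParts (D.side (s.toFun (i + 1)) (s.toFun i))) := fun i =>
    hfin.finiteCut_unionParts (D.finiteCut_side _ _)
  obtain ⟨r, hr⟩ := hG.exists_ray_of_finiteCuts hcut (x := x) (fun v => by
      obtain ⟨t, ht⟩ := D.exists_mem_part v
      obtain ⟨i, hi⟩ := (eventually_notMem_side_ray s t).exists
      exact ⟨i, fun h => hi ((D.mem_unionParts_iff_of_mem_part ht).1 h)⟩)
    (fun i j h => s.injective (D.eq_of_mem_part (hx i) (h ▸ hx j)))
    (fun i => by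
      filter_upwards [livesIn_side_ray s i s rfl] with j hj
      exact (D.mem_unionParts_iff_of_mem_part (hx j)).2 hj)
  exact ⟨r.edgeEnd, pointsTo_edgeEnd hfin fun n => (Ray.livesIn_edgeEnd_iff (hcut n)).2 (hr n)⟩

end TreeCutDecomposition

end SimpleGraph

open SimpleGraph SimpleGraph.TreeCutDecomposition SimpleGraph.VertexOrEdgeEnd in
theorem theorem3p1 {V N : Type*} (G : SimpleGraph V) (hG : G.Connected)
    (D : G.TreeCutDecomposition N) (hfin : D.FiniteAdhesion)
    (hblocks : Set.range D.part = G.omegaEdgeBlocks)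
    (hadj : ∀ t₁ t₂, D.tree.Adj t₁ t₂ → ∃ x ∈ D.part t₁, ∃ y ∈ D.part t₂, G.Adj x y) :
    ∃ φ : G.EdgeEnd → D.tree.VertexOrEdgeEnd,
      (∀ ω x, D.PointsTo ω x ↔ x = φ ω) ∧
      Topology.IsEmbedding φ ∧
      Set.BijOn φ {ω | ¬ ω.IsDominated} (Set.range SimpleGraph.VertexOrEdgeEnd.edgeEnd) ∧
      Set.InjOn φ {ω | ω.IsDominated} ∧
      ∀ ω : G.EdgeEnd, ω.IsDominated →
        ∃ t, φ ω = SimpleGraph.VertexOrEdgeEnd.vertex t ∧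
          D.part t = {v | G.EdgeDominates v ω} := by
  choose φ hφ using exists_pointsTo hfin
  have hinj := injective_of_pointsTo hfin hblocks hadj hφ
  have hdom : ∀ ω v t, v ∈ D.part t → (G.EdgeDominates v ω ↔ φ ω = vertex t) :=
    fun ω v t hv => (hφ ω).edgeDominates_iff hfin hblocks hadj hv
  refine ⟨φ, fun ω x => ⟨fun h => h.unique hfin (hφ ω), fun h => h ▸ hφ ω⟩,
    ⟨isInducing_of_pointsTo hfin hblocks hadj hφ, hinj⟩, ⟨?_, hinj.injOn, ?_⟩, hinj.injOn, ?_⟩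
  · intro ω hω
    cases h : φ ω with
    | vertex t =>
      obtain ⟨v, hv⟩ := D.part_nonempty t
      exact absurd ⟨v, (hdom ω v t hv).2 h⟩ hω
    | edgeEnd ε => exact ⟨ε, rfl⟩
  · rintro _ ⟨ε, rfl⟩
    obtain ⟨ω, hω⟩ := exists_pointsTo_edgeEnd hG hfin ε
    have h : φ ω = edgeEnd ε := (hφ ω).unique hfin hω
    refine ⟨ω, ?_, h⟩
    -- A dominating vertex would force `φ ω` to be a node.
    rintro ⟨v, hv⟩
    obtain ⟨t, ht⟩ := D.exists_mem_part v
    exact nomatch h.symm.trans ((hdom ω v t ht).1 hv)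
  · rintro ω ⟨v, hv⟩
    obtain ⟨t, ht⟩ := D.exists_mem_part v
    have h := (hdom ω v t ht).1 hv
    refine ⟨t, h, ?_⟩
    ext u
    refine ⟨fun hu => (hdom ω u t hu).2 h, fun hu => ?_⟩
    obtain ⟨s, hs⟩ := D.exists_mem_part u
    have : vertex s = vertex t := ((hdom ω u s hs).1 hu).symm.trans h
    cases this
    exact hs
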